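/- Let $X$ be a real Banach space with closed unit ball $\mathbb{B}_X$. For a closed convex set $C\subseteq X$ and $x\in C$, a hyperplane supporting $C$ at $x$ is a set $\{y\in X:\varphi(y)=\varphi(x)\}$ with $\varphi\in X^*\setminus\{0\}$ and $\varphi(x)=\sup_{z\in C}\varphi(z)$; the point $x$ is called an almost exposed point of $C$ if it is the only point of $C$ that lies on all hyperplanes supporting $C$ at $x$. A map $F\colon\mathbb{B}_X\to\mathbb{B}_X$ is called nonexpansive if $\|F(x)-F(y)\|\le\|x-y\|$ for all $x,y\in\mathbb{B}_X$. Suppose that $X$ satisfies at least one of the following conditions: (i) $\mathbb{B}_X$ is the closed convex hull of its almost exposed points; (ii) $X$ is isometrically isomorphic to the space $C(K)$ of continuous real-valued functions, with the supremum norm, on some compact Hausdorff space $K$; (iii) $X$ is isometrically isomorphic to the space $c_0$ of real null sequences with the supremum norm. Then every surjective isometry $f\colon\mathbb{B}_X\to\mathbb{B}_X$ (not assumed linear) is an extreme point of the convex set $\mathcal{M}$ of all nonexpansive maps $\mathbb{B}_X\to\mathbb{B}_X$; that is, if $f=(1-\lambda)g+\lambda h$ with $\lambda\in(0,1)$ and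 $g,h\in\mathcal{M}$, then $g=h=f$. -/

import Mathlib

open scoped ZeroAtInfty

/-- `H` is a (closed, real) hyperplane supporting the set `C` at its point `x`: `H` is the level set
through `x` of a nonzero continuous real functional whose maximum over `C` is attained at `x`. -/
def IsSupportingHyperplaneAt {X : Type*} [NormedAddCommGroup X] [NormedSpace ℝ X]
    (C : Set X) (x : X) (H : Set X) : Prop :=
  x ∈ C ∧ ∃ φ : StrongDual ℝ X, φ ≠ 0 ∧ (∀ z ∈ C, φ z ≤ φ x) ∧ H = {y | φ y = φ x}

/-- The almost exposed points of `C`: those `x ∈ C` which are the only point of `C` lying on every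
hyperplane that supports `C` at `x`. -/
def almostExposedPoints {X : Type*} [NormedAddCommGroup X] [NormedSpace ℝ X]
    (C : Set X) : Set X :=
  {x | x ∈ C ∧ C ∩ ⋂₀ {H | IsSupportingHyperplaneAt C x H} = {x}}

/-- The nonexpansive self-maps of `C`, as a subset of the vector space of all maps `C → X`. -/
def nonexpansiveSelfMaps {X : Type*} [NormedAddCommGroup X] [NormedSpace ℝ X]
    (C : Set X) : Set (C → X) :=
  {F | (∀ x, F x ∈ C) ∧ ∀ x y, ‖F x - F y‖ ≤ ‖(x : X) - (y : X)‖}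

/-!
In the ball, the midpoint of two points not too far from the center is the center of symmetry of a
metrically defined set, namely of the points no farther from either of them than half their
distance. A center of symmetry of a bounded metric space is fixed by every isometry of that space
onto itself, so a surjective isometry of the unit ball fixes `0` and preserves such midpoints. It
then commutes with halving, so it preserves all midpoints and, being continuous, is affine.
Composing with its inverse reduces the theorem to the identity map.

If the identity is not extreme, there is `u ≠ 0` such that `x ↦ x + u x` and `x ↦ x - u x` are
both nonexpansive self-maps of the ball. Between `x` and `x + t e`, with `e` an extreme point of
the ball, `u` changes by some `w` with `‖t e ± w‖ ≤ t`, hence not at all, and `u e = 0` because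
`e ± u e` lie in the ball; so `u` is zero if the ball is the closed convex hull of its extreme
points, among which are the almost exposed ones. In `C₀(K)`, comparing `x` with a function `y` in
the ball that has `y s = 1` and `‖y - x‖ = y s - x s` shows that `u x` vanishes at `s`.
-/

open Metric Set AffineIsometryEquiv

section CenterOfSymmetry

variable {α β : Type*} [MetricSpace α] [MetricSpace β] {S : Set α} {z z' : α}

/-- `z` is a center of symmetry of `S`: some isometry of `S` onto itself moves every point to twice
its distance from `z`, as the point reflection `x ↦ 2z - x` does. Being purely metric, the notion is
transported by isometries that are not known to be affine. -/
def IsCenterOfSymmetry (S : Set α) (z : α) : Prop :=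
  z ∈ S ∧ ∃ R : S ≃ᵢ S, ∀ x, dist (R x) x = 2 * dist (x : α) z

theorem IsCenterOfSymmetry.image (hz : IsCenterOfSymmetry S z) (e : α ≃ᵢ β) :
    IsCenterOfSymmetry (e '' S) (e z) := by
  obtain ⟨hzS, R, hR⟩ := hz
  let eS : S ≃ᵢ e '' S := ⟨e.toEquiv.image S, fun x y => e.isometry x y⟩
  refine ⟨mem_image_of_mem e hzS, (eS.symm.trans R).trans eS, fun y => ?_⟩
  obtain ⟨x, rfl⟩ := eS.surjective y
  have hx : dist (eS x : β) (e z) = dist (x : α) z := e.dist_eq x z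
  simp only [IsometryEquiv.trans_apply, IsometryEquiv.symm_apply_apply, eS.dist_eq, hR, hx]

/-- Conjugating the reflection by `e` gives an isometry that moves `z` twice as far as `e` does, so
the supremum of these displacements is zero. -/
theorem IsCenterOfSymmetry.apply_eq (hS : Bornology.IsBounded S) (hz : IsCenterOfSymmetry S z)
    (e : S ≃ᵢ S) : e ⟨z, hz.1⟩ = ⟨z, hz.1⟩ := by
  obtain ⟨hzS, R, hR⟩ := hz
  set c : S := ⟨z, hzS⟩
  have hbdd : BddAbove (range fun e : S ≃ᵢ S => dist (e c) c) :=
    ⟨diam S, forall_mem_range.2 fun e => dist_le_diam_of_mem hS (e c).2 hzS⟩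
  have hdouble (e : S ≃ᵢ S) : 2 * dist (e c) c ≤ ⨆ e : S ≃ᵢ S, dist (e c) c :=
    calc 2 * dist (e c) c = dist (R (e c)) (e c) := (hR (e c)).symm
      _ = dist (e.symm (R (e c))) c := by rw [← e.dist_eq (e.symm _), e.apply_symm_apply]
      _ ≤ ⨆ e : S ≃ᵢ S, dist (e c) c := le_ciSup hbdd ((e.trans R).trans e.symm)
  have hhalf : ⨆ e : S ≃ᵢ S, dist (e c) c ≤ (⨆ e : S ≃ᵢ S, dist (e c) c) / 2 :=
    ciSup_le fun e => by linarith [hdouble e]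
  exact dist_le_zero.1 (by linarith [hdouble e])

theorem IsCenterOfSymmetry.eq (hS : Bornology.IsBounded S) (hz : IsCenterOfSymmetry S z)
    (hz' : IsCenterOfSymmetry S z') : z = z' := by
  obtain ⟨_, R', hR'⟩ := hz'
  have h := hR' ⟨z, hz.1⟩
  rw [hz.apply_eq hS R', dist_self] at h
  exact dist_le_zero.1 (by linarith)

end CenterOfSymmetry

section Midpoint

variable {E F : Type*} [NormedAddCommGroup E] [NormedSpace ℝ E] [NormedAddCommGroup F]
  [NormedSpace ℝ F]

theorem isCenterOfSymmetry_of_pointReflection {C : Set E} {S : Set C} {z : C} (hz : z ∈ S)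
    (hS : ∀ x ∈ S, ∃ y ∈ S, (y : E) = pointReflection ℝ (z : E) x) : IsCenterOfSymmetry S z := by
  choose! ρ hρS hρ using hS
  let R : S → S := fun x => ⟨ρ x, hρS x x.2⟩
  have hR (x : S) : (R x : E) = pointReflection ℝ (z : E) x := hρ x x.2
  have hinv : Function.Involutive R := fun x =>
    Subtype.ext <| Subtype.ext <| by rw [hR, hR, pointReflection_involutive]
  refine ⟨hz, ⟨hinv.toPerm, Isometry.of_dist_eq fun x y => ?_⟩, fun x => ?_⟩
  · change dist (R x : E) (R y) = dist (x : E) y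
    rw [hR, hR, (pointReflection ℝ (z : E)).dist_map]
  · change dist (R x : E) (x : E) = 2 * dist (x : E) z
    rw [hR, dist_pointReflection_self_real, dist_comm]

theorem isCenterOfSymmetry_inter_closedBall {C : Set E} {x y z : C}
    (hz : (z : E) = midpoint ℝ (x : E) y) (hC : closedBall (x : E) (dist x y / 2) ⊆ C) :
    IsCenterOfSymmetry (closedBall x (dist x y / 2) ∩ closedBall y (dist x y / 2)) z := by
  refine isCenterOfSymmetry_of_pointReflection ⟨?_, ?_⟩ fun w hw => ?_
  · rw [mem_closedBall, Subtype.dist_eq, hz, dist_midpoint_left, Subtype.dist_eq]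
    norm_num [div_eq_inv_mul]
  · rw [mem_closedBall, Subtype.dist_eq, hz, dist_midpoint_right, Subtype.dist_eq]
    norm_num [div_eq_inv_mul]
  · have hx : dist (pointReflection ℝ (z : E) w) x = dist w y := by
      rw [← pointReflection_midpoint_right (x : E) y, ← hz, AffineIsometryEquiv.dist_map]; rfl
    have hy : dist (pointReflection ℝ (z : E) w) y = dist w x := by
      rw [← pointReflection_midpoint_left (x : E) y, ← hz, AffineIsometryEquiv.dist_map]; rfl
    exact ⟨⟨_, hC (hx.trans_le hw.2)⟩, ⟨hx.trans_le hw.2, hy.trans_le hw.1⟩, rfl⟩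

theorem isometryEquiv_apply_midpoint {C : Set E} {D : Set F} (e : C ≃ᵢ D) {x y z : C} {z' : D}
    (hz : (z : E) = midpoint ℝ (x : E) y) (hz' : (z' : F) = midpoint ℝ (e x : F) (e y))
    (hC : closedBall (x : E) (dist x y / 2) ⊆ C) (hD : closedBall (e x : F) (dist x y / 2) ⊆ D) :
    e z = z' := by
  have h := (isCenterOfSymmetry_inter_closedBall hz hC).image e
  rw [image_inter e.injective, e.image_closedBall, e.image_closedBall, ← e.dist_eq x y] at h
  refine h.eq (isBounded_closedBall.subset inter_subset_left)
    (isCenterOfSymmetry_inter_closedBall hz' ?_)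
  rwa [e.dist_eq]

end Midpoint

section Affine

theorem ordConnected_of_isClosed_of_midpoint_mem {S : Set ℝ} (hS : IsClosed S)
    (hmid : ∀ x ∈ S, ∀ y ∈ S, midpoint ℝ x y ∈ S) : S.OrdConnected := by
  refine ⟨fun a ha b hb => (hS.inter isClosed_Icc).Icc_subset_of_forall_exists_gt ha ?_⟩
  rintro x ⟨hx, -, hxb⟩ y (hxy : x < y)
  have hdyadic (n : ℕ) : x + (1 / 2) ^ n * (b - x) ∈ S := by
    induction n with
    | zero => simpa using hb
    | succ n ih =>
      convert hmid x hx _ ih using 1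
      rw [midpoint_eq_smul_add, invOf_eq_inv, smul_eq_mul]
      ring
  have hbx : 0 < b - x := sub_pos.2 hxb
  obtain ⟨n, hn⟩ := exists_pow_lt_of_lt_one (div_pos (sub_pos.2 hxy) hbx)
    (by norm_num : (1 / 2 : ℝ) < 1)
  rw [lt_div_iff₀ hbx] at hn
  exact ⟨_, hdyadic n, lt_add_of_pos_right _ (by positivity), by linarith⟩

theorem convex_of_isClosed_of_midpoint_mem {E : Type*} [AddCommGroup E] [Module ℝ E]
    [TopologicalSpace E] [IsTopologicalAddGroup E] [ContinuousSMul ℝ E] {S : Set E}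
    (hS : IsClosed S) (hmid : ∀ x ∈ S, ∀ y ∈ S, midpoint ℝ x y ∈ S) : Convex ℝ S := by
  refine convex_iff_segment_subset.2 fun x hx y hy => ?_
  have hline : (AffineMap.lineMap x y ⁻¹' S : Set ℝ).OrdConnected :=
    ordConnected_of_isClosed_of_midpoint_mem (hS.preimage AffineMap.lineMap_continuous)
      fun s hs t ht => by
        rw [mem_preimage, AffineMap.map_midpoint]
        exact hmid _ hs _ ht
  rw [segment_eq_image_lineMap, image_subset_iff]
  exact hline.out (by simpa using hx) (by simpa using hy)

variable {E F : Type*} [AddCommGroup E] [Module ℝ E] [AddCommGroup F] [Module ℝ F]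

/-- `φ` is affine on the convex set `C`. It is a map on the subtype `C`, so a convex combination
enters as a point `z` of `C` with `z = a • x + b • y`. -/
def IsAffineOn {C : Set E} (φ : C → F) : Prop :=
  ∀ ⦃x y z : C⦄ ⦃a b : ℝ⦄, 0 ≤ a → 0 ≤ b → a + b = 1 → (z : E) = a • (x : E) + b • (y : E) →
    φ z = a • φ x + b • φ y

theorem isAffineOn_of_map_midpoint [TopologicalSpace E] [IsTopologicalAddGroup E]
    [ContinuousSMul ℝ E] [TopologicalSpace F] [IsTopologicalAddGroup F] [ContinuousSMul ℝ F]
    [T2Space F] {C : Set E} (hC : IsClosed C) (hconv : Convex ℝ C) {φ : C → F} (hφ : Continuous φ)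
    (hmid : ∀ x y z : C, (z : E) = midpoint ℝ (x : E) y → φ z = midpoint ℝ (φ x) (φ y)) :
    IsAffineOn φ := by
  let G : Set (E × F) := range fun x : C => ((x : E), φ x)
  have hG_closed : IsClosed G := by
    have hG : G = Prod.map (↑) id '' {p : C × F | φ p.1 = p.2} := by
      ext p
      constructor
      · rintro ⟨x, rfl⟩
        exact ⟨(x, φ x), rfl, rfl⟩
      · rintro ⟨⟨x, _⟩, hx, rfl⟩
        exact ⟨x, Prod.ext rfl hx⟩
    rw [hG]
    exact (hC.isClosedEmbedding_subtypeVal.prodMap .id).isClosedMap _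
      (isClosed_eq (hφ.comp continuous_fst) continuous_snd)
  have hG_convex : Convex ℝ G := by
    refine convex_of_isClosed_of_midpoint_mem hG_closed ?_
    rintro _ ⟨x, rfl⟩ _ ⟨y, rfl⟩
    exact ⟨⟨_, hconv.midpoint_mem x.2 y.2⟩, Prod.ext rfl (hmid x y _ rfl)⟩
  intro x y z a b ha hb hab hz
  obtain ⟨w, hw⟩ := hG_convex (mem_range_self x) (mem_range_self y) ha hb hab
  have hwz : w = z := Subtype.ext <| (congrArg Prod.fst hw).trans hz.symm
  exact hwz ▸ congrArg Prod.snd hw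

end Affine

section UnitBall

variable {E F : Type*} [NormedAddCommGroup E] [NormedSpace ℝ E] [NormedAddCommGroup F]
  [NormedSpace ℝ F] (e : closedBall (0 : E) 1 ≃ᵢ closedBall (0 : F) 1)
  {x y z : closedBall (0 : E) 1}

theorem isCenterOfSymmetry_univ_closedBall (hx : (x : E) = 0) : IsCenterOfSymmetry univ x :=
  isCenterOfSymmetry_of_pointReflection (mem_univ x) fun y _ =>
    ⟨-y, mem_univ _, by simp [hx, pointReflection_apply]⟩

theorem closedBall_isometryEquiv_apply_zero (hx : (x : E) = 0) : (e x : F) = 0 := by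
  let o : closedBall (0 : F) 1 := ⟨0, mem_closedBall_self zero_le_one⟩
  have := (isBounded_closedBall (x := (0 : F)) (r := 1)).boundedSpace_val
  have h := (isCenterOfSymmetry_univ_closedBall hx).image e
  rw [image_univ_of_surjective e.surjective] at h
  exact congrArg Subtype.val (h.eq (.all _) (isCenterOfSymmetry_univ_closedBall (x := o) rfl))

theorem norm_closedBall_isometryEquiv_apply (x : closedBall (0 : E) 1) :
    ‖(e x : F)‖ = ‖(x : E)‖ := by
  let o : closedBall (0 : E) 1 := ⟨0, mem_closedBall_self zero_le_one⟩
  have h : dist (e x : F) (e o) = dist (x : E) 0 := e.dist_eq x o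
  rwa [closedBall_isometryEquiv_apply_zero e (x := o) rfl, dist_zero_right,
    dist_zero_right] at h

theorem closedBall_isometryEquiv_apply_midpoint_of_norm_add_le (hz : (z : E) = midpoint ℝ (x : E) y)
    (hxy : ‖(x : E)‖ + dist x y / 2 ≤ 1) : (e z : F) = midpoint ℝ (e x : F) (e y) := by
  have hmem := (convex_closedBall (0 : F) 1).midpoint_mem (e x).2 (e y).2
  refine congrArg Subtype.val (isometryEquiv_apply_midpoint e (z' := ⟨_, hmem⟩) hz rfl ?_ ?_) <;>
    refine closedBall_subset_closedBall' ?_ <;> rw [dist_zero_right]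
  · linarith
  · rw [norm_closedBall_isometryEquiv_apply]
    linarith

theorem closedBall_isometryEquiv_apply_half_smul (hy : (y : E) = (1 / 2 : ℝ) • (x : E)) :
    (e y : F) = (1 / 2 : ℝ) • (e x : F) := by
  let o : closedBall (0 : E) 1 := ⟨0, mem_closedBall_self zero_le_one⟩
  have hox : dist o x = ‖(x : E)‖ := dist_zero_left _
  have hx : ‖(x : E)‖ ≤ 1 := mem_closedBall_zero_iff.1 x.2
  have h := closedBall_isometryEquiv_apply_midpoint_of_norm_add_le e (x := o) (y := x) (z := y)
    (by simp [hy, o, midpoint_eq_smul_add]) (by simp only [o, norm_zero, hox]; linarith)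
  simpa [closedBall_isometryEquiv_apply_zero e (x := o) rfl, midpoint_eq_smul_add] using h

/-- Halving `x` and `y`, which `e` respects, brings them close enough to the center for
`closedBall_isometryEquiv_apply_midpoint_of_norm_add_le`. -/
theorem closedBall_isometryEquiv_apply_midpoint (hz : (z : E) = midpoint ℝ (x : E) y) :
    (e z : F) = midpoint ℝ (e x : F) (e y) := by
  have hhalf (w : closedBall (0 : E) 1) : ‖(1 / 2 : ℝ) • (w : E)‖ ≤ 1 / 2 := by
    rw [norm_smul, Real.norm_of_nonneg (by norm_num)]
    linarith [mem_closedBall_zero_iff.1 w.2]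
  let half (w : closedBall (0 : E) 1) : closedBall (0 : E) 1 :=
    ⟨(1 / 2 : ℝ) • (w : E), mem_closedBall_zero_iff.2 ((hhalf w).trans (by norm_num))⟩
  have hdist : dist (half x) (half y) ≤ 1 / 2 + 1 / 2 :=
    (dist_le_norm_add_norm _ _).trans (add_le_add (hhalf x) (hhalf y))
  have h := closedBall_isometryEquiv_apply_midpoint_of_norm_add_le e (x := half x) (y := half y)
    (z := half z)
    (by simp only [half, hz, midpoint_eq_smul_add]; module)
    (by have := hhalf x; simp only [half] at hdist ⊢; linarith)
  rw [closedBall_isometryEquiv_apply_half_smul e (x := x) (y := half x) rfl,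
    closedBall_isometryEquiv_apply_half_smul e (x := y) (y := half y) rfl,
    closedBall_isometryEquiv_apply_half_smul e (x := z) (y := half z) rfl] at h
  refine smul_right_injective F (one_half_pos.ne' : (1 / 2 : ℝ) ≠ 0) (h.trans ?_)
  simp only [midpoint_eq_smul_add]
  module

theorem isAffineOn_closedBall_isometryEquiv : IsAffineOn fun x => (e x : F) :=
  isAffineOn_of_map_midpoint isClosed_closedBall (convex_closedBall 0 1)
    (continuous_subtype_val.comp e.continuous) fun _ _ _ =>
      closedBall_isometryEquiv_apply_midpoint e

end UnitBall

section Nonexpansive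

variable {X : Type*} [NormedAddCommGroup X] [NormedSpace ℝ X] {C : Set X}

theorem convex_nonexpansiveSelfMaps (hC : Convex ℝ C) : Convex ℝ (nonexpansiveSelfMaps C) := by
  intro F hF G hG a b ha hb hab
  refine ⟨fun x => hC (hF.1 x) (hG.1 x) ha hb hab, fun x y => ?_⟩
  calc ‖(a • F + b • G) x - (a • F + b • G) y‖
      = ‖a • (F x - F y) + b • (G x - G y)‖ := by
        simp only [Pi.add_apply, Pi.smul_apply]
        congr 1
        module
    _ ≤ ‖a • (F x - F y)‖ + ‖b • (G x - G y)‖ := norm_add_le _ _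
    _ = a * ‖F x - F y‖ + b * ‖G x - G y‖ := by
        rw [norm_smul_of_nonneg ha, norm_smul_of_nonneg hb]
    _ ≤ a * ‖(x : X) - y‖ + b * ‖(x : X) - y‖ := by gcongr; exacts [hF.2 x y, hG.2 x y]
    _ = ‖(x : X) - y‖ := by rw [← add_mul, hab, one_mul]

theorem mem_extremePoints_nonexpansiveSelfMaps_of_isAffineOn_symm {e : C ≃ᵢ C}
    (he : IsAffineOn fun x => (e.symm x : X))
    (hid : Subtype.val ∈ extremePoints ℝ (nonexpansiveSelfMaps C)) :
    (fun x => (e x : X)) ∈ extremePoints ℝ (nonexpansiveSelfMaps C) := by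
  have hcomp {F : C → X} (hF : F ∈ nonexpansiveSelfMaps C) :
      (fun x => (e.symm ⟨F x, hF.1 x⟩ : X)) ∈ nonexpansiveSelfMaps C := by
    refine ⟨fun x => Subtype.coe_prop _, fun x y => ?_⟩
    rw [← dist_eq_norm, ← Subtype.dist_eq, e.symm.dist_eq, Subtype.dist_eq, dist_eq_norm]
    exact hF.2 x y
  refine mem_extremePoints_iff_left.2 ⟨⟨fun x => (e x).2, fun x y => ?_⟩, ?_⟩
  · rw [← dist_eq_norm, ← Subtype.dist_eq, e.dist_eq, Subtype.dist_eq, dist_eq_norm]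
  rintro g hg h hh ⟨a, b, ha, hb, hab, hgh⟩
  have hsegment : Subtype.val ∈ openSegment ℝ (fun x => (e.symm ⟨g x, hg.1 x⟩ : X))
      fun x => (e.symm ⟨h x, hh.1 x⟩ : X) := by
    refine ⟨a, b, ha, hb, hab, funext fun x => ?_⟩
    have := he (x := ⟨g x, hg.1 x⟩) (y := ⟨h x, hh.1 x⟩) (z := e x) ha.le hb.le hab
      (congrFun hgh x).symm
    simpa using this.symm
  have hg_eq := (mem_extremePoints_iff_left.1 hid).2 _ (hcomp hg) _ (hcomp hh) hsegment
  funext x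
  exact congrArg Subtype.val (e.toEquiv.symm_apply_eq.1 (Subtype.ext (congrFun hg_eq x)))

end Nonexpansive

section ExtremePoints

theorem mem_extremePoints_iff_add_sub {E : Type*} [AddCommGroup E] [Module ℝ E] {A : Set E}
    (hA : Convex ℝ A) {x : E} :
    x ∈ extremePoints ℝ A ↔ x ∈ A ∧ ∀ v, x + v ∈ A → x - v ∈ A → v = 0 := by
  constructor
  · refine fun hx => ⟨hx.1, fun v hadd hsub => ?_⟩
    have hmem : x ∈ openSegment ℝ (x + v) (x - v) :=
      ⟨1 / 2, 1 / 2, by norm_num, by norm_num, by norm_num, by module⟩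
    exact add_eq_left.1 ((mem_extremePoints_iff_left.1 hx).2 _ hadd _ hsub hmem)
  · rintro ⟨hx, h⟩
    refine mem_extremePoints_iff_left.2 ⟨hx, ?_⟩
    rintro y hy z hz ⟨a, b, ha, hb, hab, rfl⟩
    obtain rfl : b = 1 - a := by linarith
    have hv := h (a • (y - (a • y + (1 - a) • z)))
      (by convert hA hx hy hb.le ha.le (by ring) using 1; module)
      (by convert hA hx hz ha.le hb.le hab using 1; module)
    exact sub_eq_zero.1 ((smul_eq_zero.1 hv).resolve_left ha.ne')

variable {X : Type*} [NormedAddCommGroup X] [NormedSpace ℝ X] {e w : X} {t : ℝ}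

theorem almostExposedPoints_subset_extremePoints {C : Set X} (hC : Convex ℝ C) :
    almostExposedPoints C ⊆ extremePoints ℝ C := by
  rintro x ⟨hx, hexp⟩
  refine (mem_extremePoints_iff_add_sub hC).2 ⟨hx, fun v hadd hsub => ?_⟩
  have hmem : x + v ∈ C ∩ ⋂₀ {H | IsSupportingHyperplaneAt C x H} := by
    refine ⟨hadd, ?_⟩
    rintro _ ⟨-, φ, -, hφ, rfl⟩
    have h₁ := hφ _ hadd
    have h₂ := hφ _ hsub
    rw [map_add] at h₁
    rw [map_sub] at h₂
    rw [mem_ofPred_eq, map_add]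
    linarith
  rw [hexp] at hmem
  exact add_eq_left.1 hmem

theorem eq_zero_of_norm_smul_add_le_of_norm_smul_sub_le
    (he : e ∈ extremePoints ℝ (closedBall (0 : X) 1)) (ht : 0 ≤ t) (hadd : ‖t • e + w‖ ≤ t)
    (hsub : ‖t • e - w‖ ≤ t) : w = 0 := by
  obtain rfl | ht := ht.eq_or_lt
  · simpa using hadd
  have hmem {v : X} (hv : ‖t • e + v‖ ≤ t) : e + t⁻¹ • v ∈ closedBall (0 : X) 1 := by
    rw [mem_closedBall_zero_iff, ← inv_smul_smul₀ ht.ne' e, ← smul_add,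
      norm_smul_of_nonneg (inv_nonneg.2 ht.le)]
    exact inv_mul_le_one_of_le₀ hv ht.le
  have hw := ((mem_extremePoints_iff_add_sub (convex_closedBall 0 1)).1 he).2 (t⁻¹ • w) (hmem hadd)
    (by simpa only [smul_neg, ← sub_eq_add_neg] using hmem (v := -w) (by rwa [← sub_eq_add_neg]))
  exact (smul_eq_zero.1 hw).resolve_left (inv_ne_zero ht.ne')

end ExtremePoints

section Perturbation

variable {X : Type*} [NormedAddCommGroup X] [NormedSpace ℝ X] {C : Set X}

/-- `u` is a perturbation of the identity of `C` for which both `x ↦ x + u x` and `x ↦ x - u x` are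
nonexpansive self-maps of `C`. The identity is an extreme point of the nonexpansive self-maps of a
convex set if and only if it has no such perturbation but zero. -/
def IsNonexpansivePerturbation (u : C → X) : Prop :=
  Subtype.val + u ∈ nonexpansiveSelfMaps C ∧ Subtype.val - u ∈ nonexpansiveSelfMaps C

namespace IsNonexpansivePerturbation

theorem norm_add_le {u : C → X} (hu : IsNonexpansivePerturbation u) (x y : C) :
    ‖((x : X) - y) + (u x - u y)‖ ≤ ‖(x : X) - y‖ := by
  rw [← add_sub_add_comm]
  exact hu.1.2 x y

theorem norm_sub_le {u : C → X} (hu : IsNonexpansivePerturbation u) (x y : C) :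
    ‖((x : X) - y) - (u x - u y)‖ ≤ ‖(x : X) - y‖ := by
  rw [← sub_sub_sub_comm]
  exact hu.2.2 x y

theorem lipschitzWith {u : C → X} (hu : IsNonexpansivePerturbation u) : LipschitzWith 1 u := by
  refine LipschitzWith.of_dist_le_mul fun x y => ?_
  rw [NNReal.coe_one, one_mul, Subtype.dist_eq, dist_eq_norm, dist_eq_norm]
  have htwo := norm_sub_le_of_le (hu.norm_add_le x y) (hu.norm_sub_le x y)
  rw [add_sub_sub_cancel, ← two_smul ℝ (u x - u y), norm_smul_of_nonneg zero_le_two] at htwo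
  linarith

variable {u : closedBall (0 : X) 1 → X} (hu : IsNonexpansivePerturbation u)
  {x y : closedBall (0 : X) 1} {v : X} {t : ℝ}
include hu

theorem apply_eq_zero_of_mem_extremePoints (hx : (x : X) ∈ extremePoints ℝ (closedBall 0 1)) :
    u x = 0 :=
  ((mem_extremePoints_iff_add_sub (convex_closedBall 0 1)).1 hx).2 _ (hu.1.1 x) (hu.2.1 x)

theorem apply_eq_of_coe_eq_add_smul (hv : v ∈ extremePoints ℝ (closedBall (0 : X) 1)) (ht : 0 ≤ t)
    (hy : (y : X) = x + t • v) : u y = u x := by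
  have hsub : (y : X) - x = t • v := sub_eq_of_eq_add' hy
  have hnorm : ‖(y : X) - x‖ ≤ t := by
    rw [hsub, norm_smul_of_nonneg ht]
    exact mul_le_of_le_one_right ht (mem_closedBall_zero_iff.1 hv.1)
  refine sub_eq_zero.1 (eq_zero_of_norm_smul_add_le_of_norm_smul_sub_le hv ht ?_ ?_) <;>
    rw [← hsub]
  · exact (hu.norm_add_le y x).trans hnorm
  · exact (hu.norm_sub_le y x).trans hnorm

/-- A step along a convex combination is a succession of steps along its members. -/
theorem apply_eq_of_coe_eq_add_smul_of_mem_convexHull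
    (hv : v ∈ convexHull ℝ (extremePoints ℝ (closedBall (0 : X) 1))) (ht : 0 ≤ t)
    (hxt : ‖(x : X)‖ + t ≤ 1) (hy : (y : X) = x + t • v) : u y = u x := by
  let S : Set X := {v ∈ closedBall 0 1 | ∀ (x y : closedBall (0 : X) 1) (t : ℝ), 0 ≤ t →
    ‖(x : X)‖ + t ≤ 1 → (y : X) = x + t • v → u y = u x}
  have hext : extremePoints ℝ (closedBall (0 : X) 1) ⊆ S := fun v hv =>
    ⟨hv.1, fun _ _ _ ht _ => hu.apply_eq_of_coe_eq_add_smul hv ht⟩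
  have hS : Convex ℝ S := by
    intro v hv w hw a b ha hb hab
    refine ⟨convex_closedBall 0 1 hv.1 hw.1 ha hb hab, fun x y t ht hxt hy => ?_⟩
    have hnorm : ‖(x : X) + (t * a) • v‖ ≤ ‖(x : X)‖ + t * a := by
      refine norm_add_le_of_le le_rfl ?_
      rw [norm_smul_of_nonneg (mul_nonneg ht ha)]
      exact mul_le_of_le_one_right (mul_nonneg ht ha) (mem_closedBall_zero_iff.1 hv.1)
    have hsum : t * a + t * b = t := by rw [← mul_add, hab, mul_one]
    have hta : 0 ≤ t * a := mul_nonneg ht ha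
    have htb : 0 ≤ t * b := mul_nonneg ht hb
    let z : closedBall (0 : X) 1 := ⟨x + (t * a) • v, mem_closedBall_zero_iff.2 (by linarith)⟩
    have hzx : u z = u x := hv.2 x z (t * a) hta (by linarith) rfl
    have hyz : u y = u z := hw.2 z y (t * b) htb (by linarith) (by rw [hy]; module)
    exact hyz.trans hzx
  exact (convexHull_min hext hS hv).2 x y t ht hxt hy

theorem eq_zero_of_closedBall_subset_closure_convexHull
    (hX : closedBall (0 : X) 1 ⊆ closure (convexHull ℝ (extremePoints ℝ (closedBall 0 1)))) :
    u = 0 := by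
  let o : closedBall (0 : X) 1 := ⟨0, mem_closedBall_self zero_le_one⟩
  have hconst {x : closedBall (0 : X) 1}
      (hx : (x : X) ∈ convexHull ℝ (extremePoints ℝ (closedBall (0 : X) 1))) : u x = u o :=
    hu.apply_eq_of_coe_eq_add_smul_of_mem_convexHull hx zero_le_one (by simp [o]) (by simp [o])
  obtain ⟨v, hv⟩ := convexHull_nonempty_iff.1 (closure_nonempty_iff.1 ⟨_, hX o.2⟩)
  have ho : u o = 0 := by
    rw [← hconst (x := ⟨v, hv.1⟩) (subset_convexHull ℝ _ hv),
      hu.apply_eq_zero_of_mem_extremePoints hv]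
  have hclosed : IsClosed ((↑) '' (u ⁻¹' {0}) : Set X) :=
    isClosed_closedBall.isClosedEmbedding_subtypeVal.isClosedMap _
      (isClosed_singleton.preimage hu.lipschitzWith.continuous)
  have hhull : convexHull ℝ (extremePoints ℝ (closedBall (0 : X) 1)) ⊆ (↑) '' (u ⁻¹' {0}) :=
    fun w hw => ⟨⟨w, convexHull_min extremePoints_subset (convex_closedBall 0 1) hw⟩,
      (hconst hw).trans ho, rfl⟩
  funext x
  obtain ⟨y, hy, hyx⟩ := closure_minimal hhull hclosed (hX x.2)
  exact Subtype.ext hyx ▸ hy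

/-- As `φ y = 1` is the largest value of `φ` on the ball, `φ (u y) = 0`; and `x` is so close to `y`
that `φ` cannot increase from `x ± u x` to `y ± u y` by more than it does from `x` to `y`. -/
theorem map_apply_eq_zero (φ : X →ₗ[ℝ] ℝ) (hφ : ∀ v, φ v ≤ ‖v‖) (hy : φ y = 1)
    (hxy : ‖(y : X) - x‖ ≤ 1 - φ x) : φ (u x) = 0 := by
  have hball {v : X} (hv : v ∈ closedBall (0 : X) 1) : φ v ≤ 1 :=
    (hφ v).trans (mem_closedBall_zero_iff.1 hv)
  have h₁ : φ (y + u y) ≤ 1 := hball (hu.1.1 y)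
  have h₂ : φ (y - u y) ≤ 1 := hball (hu.2.1 y)
  have h₃ := (hφ _).trans ((hu.norm_add_le y x).trans hxy)
  have h₄ := (hφ _).trans ((hu.norm_sub_le y x).trans hxy)
  simp only [map_add, map_sub] at h₁ h₂ h₃ h₄
  linarith

end IsNonexpansivePerturbation

theorem val_mem_extremePoints_nonexpansiveSelfMaps (hC : Convex ℝ C)
    (h : ∀ u : C → X, IsNonexpansivePerturbation u → u = 0) :
    Subtype.val ∈ extremePoints ℝ (nonexpansiveSelfMaps C) :=
  (mem_extremePoints_iff_add_sub (convex_nonexpansiveSelfMaps hC)).2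
    ⟨⟨Subtype.coe_prop, fun _ _ => le_rfl⟩, fun u hadd hsub => h u ⟨hadd, hsub⟩⟩

end Perturbation

section ZeroAtInfty

open ZeroAtInftyContinuousMap

variable {K : Type*} [TopologicalSpace K]

theorem norm_zeroAtInfty_le_iff {x : C₀(K, ℝ)} {r : ℝ} (hr : 0 ≤ r) :
    ‖x‖ ≤ r ↔ ∀ k, |x k| ≤ r := by
  rw [← norm_toBCF_eq_norm]
  exact BoundedContinuousFunction.norm_le hr

/-- As `K` is arbitrary there may be no function peaking at `s`; `z` provides one. -/
theorem exists_zeroAtInfty_norm_sub_le_one_sub_apply {x z : C₀(K, ℝ)} {s : K} (hx : ‖x‖ ≤ 1)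
    (hz : z s ≠ 0) : ∃ y : C₀(K, ℝ), ‖y‖ ≤ 1 ∧ y s = 1 ∧ ‖y - x‖ ≤ 1 - x s := by
  have hxk (k : K) : -1 ≤ x k ∧ x k ≤ 1 := abs_le.1 ((norm_zeroAtInfty_le_iff zero_le_one).1 hx k)
  have hc : 0 ≤ 1 - x s := sub_nonneg.2 (hxk s).2
  let y : C₀(K, ℝ) :=
    { toFun k := min 1 (x k + (1 - x s) * min 1 |z k / z s|)
      zero_at_infty' := by
        have h := tendsto_const_nhds (x := (1 : ℝ)).min ((zero_at_infty x).add
          ((tendsto_const_nhds (x := (1 : ℝ)).min ((zero_at_infty z).div_const (z s)).abs).const_mul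
            (1 - x s)))
        simpa using h }
  have hy (k : K) : x k ≤ y k ∧ y k ≤ 1 ∧ y k ≤ x k + (1 - x s) := by
    have hb₀ : 0 ≤ min 1 |z k / z s| := le_min zero_le_one (abs_nonneg _)
    have hb₁ : min 1 |z k / z s| ≤ 1 := min_le_left _ _
    refine ⟨le_min (hxk k).2 (le_add_of_nonneg_right (mul_nonneg hc hb₀)), min_le_left _ _,
      (min_le_right _ _).trans ?_⟩
    gcongr
    exact mul_le_of_le_one_right hc hb₁
  refine ⟨y, (norm_zeroAtInfty_le_iff zero_le_one).2 fun k => abs_le.2 ?_, ?_,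
    (norm_zeroAtInfty_le_iff hc).2 fun k => abs_le.2 ?_⟩
  · exact ⟨(hxk k).1.trans (hy k).1, (hy k).2.1⟩
  · simp [y, div_self hz]
  · rw [ZeroAtInftyContinuousMap.sub_apply]
    constructor <;> linarith [hy k]

theorem IsNonexpansivePerturbation.eq_zero_of_linearIsometryEquiv_zeroAtInfty {X : Type*}
    [NormedAddCommGroup X] [NormedSpace ℝ X] (T : X ≃ₗᵢ[ℝ] C₀(K, ℝ))
    {u : closedBall (0 : X) 1 → X} (hu : IsNonexpansivePerturbation u) : u = 0 := by
  funext x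
  refine T.map_eq_zero_iff.1 (ZeroAtInftyContinuousMap.ext fun s => ?_)
  by_contra hs
  obtain ⟨y, hy, hys, hyx⟩ := exists_zeroAtInfty_norm_sub_le_one_sub_apply
    ((T.norm_map x).trans_le (mem_closedBall_zero_iff.1 x.2)) hs
  let φ : X →ₗ[ℝ] ℝ :=
    { toFun v := T v s
      map_add' v w := by simp
      map_smul' a v := by simp }
  refine hs (hu.map_apply_eq_zero φ (y := ⟨T.symm y, ?_⟩) (fun v => ?_) ?_ ?_)
  · rwa [mem_closedBall_zero_iff, T.symm.norm_map]
  · rw [← T.norm_map v]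
    exact (le_abs_self _).trans ((norm_zeroAtInfty_le_iff (norm_nonneg _)).1 le_rfl s)
  · simpa [φ] using hys
  · rw [← T.norm_map]
    simpa [φ] using hyx

/-- The identification of `C(K, ℝ)` with `C₀(K, ℝ)` for a compact space `K`, which makes spaces of
continuous functions a special case of spaces of functions vanishing at infinity. -/
def continuousMapLinearIsometryEquivZeroAtInfty [CompactSpace K] : C(K, ℝ) ≃ₗᵢ[ℝ] C₀(K, ℝ) where
  toFun := ContinuousMap.liftZeroAtInfty
  invFun := ContinuousMap.liftZeroAtInfty.symm
  left_inv := ContinuousMap.liftZeroAtInfty.symm_apply_apply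
  right_inv := ContinuousMap.liftZeroAtInfty.apply_symm_apply
  map_add' _ _ := rfl
  map_smul' _ _ := rfl
  norm_map' := BoundedContinuousFunction.norm_mkOfCompact

end ZeroAtInfty

theorem theorem1_general {X : Type*} [NormedAddCommGroup X] [NormedSpace ℝ X]
    (hX :
      closedBall (0 : X) 1 ⊆ closure (convexHull ℝ (extremePoints ℝ (closedBall 0 1))) ∨
      ∃ (K : Type*) (_ : TopologicalSpace K), Nonempty (X ≃ₗᵢ[ℝ] C₀(K, ℝ)))
    (f : closedBall (0 : X) 1 → closedBall (0 : X) 1) (hf : Isometry f)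
    (hfs : Function.Surjective f) :
    (fun x => (f x : X)) ∈ extremePoints ℝ (nonexpansiveSelfMaps (closedBall (0 : X) 1)) := by
  let e : closedBall (0 : X) 1 ≃ᵢ closedBall (0 : X) 1 := ⟨.ofBijective f ⟨hf.injective, hfs⟩, hf⟩
  refine mem_extremePoints_nonexpansiveSelfMaps_of_isAffineOn_symm (e := e)
    (isAffineOn_closedBall_isometryEquiv e.symm)
    (val_mem_extremePoints_nonexpansiveSelfMaps (convex_closedBall 0 1) fun u hu => ?_)
  obtain h | ⟨K, _, ⟨T⟩⟩ := hX
  · exact hu.eq_zero_of_closedBall_subset_closure_convexHull h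
  · exact hu.eq_zero_of_linearIsometryEquiv_zeroAtInfty T

theorem theorem1 {X : Type*} [NormedAddCommGroup X] [NormedSpace ℝ X] [CompleteSpace X]
    (hX :
      Metric.closedBall (0 : X) 1 =
          closure (convexHull ℝ (almostExposedPoints (Metric.closedBall (0 : X) 1))) ∨
      (∃ (K : Type*) (_ : TopologicalSpace K) (_ : CompactSpace K) (_ : T2Space K),
          Nonempty (X ≃ₗᵢ[ℝ] C(K, ℝ))) ∨
      Nonempty (X ≃ₗᵢ[ℝ] C₀(ℕ, ℝ)))
    (f : Metric.closedBall (0 : X) 1 → Metric.closedBall (0 : X) 1)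
    (hf : Isometry f) (hfs : Function.Surjective f) :
    (fun x => (f x : X)) ∈
      Set.extremePoints ℝ (nonexpansiveSelfMaps (Metric.closedBall (0 : X) 1)) := by
  obtain h | ⟨K, _, _, _, ⟨T⟩⟩ | hT := hX
  · exact theorem1_general.{_, 0} (.inl (h.subset.trans (closure_mono (convexHull_mono
      (almostExposedPoints_subset_extremePoints (convex_closedBall 0 1)))))) f hf hfs
  · exact theorem1_general
      (.inr ⟨K, _, ⟨T.trans continuousMapLinearIsometryEquivZeroAtInfty⟩⟩) f hf hfs
  · exact theorem1_general (.inr ⟨ℕ, _, hT⟩) f hf hfs
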